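/- A tournament $T$ consists of a finite vertex set $V(T)$ and a set $E(T)\subseteq V(T)\times V(T)$ of edges, containing no pair $(u,u)$ and, for all distinct $u,v\in V(T)$, exactly one of $(u,v)$ and $(v,u)$. An ordering of an $n$-vertex tournament $T$ is a bijection $\sigma:V(T)\to\{1,\dots,n\}$, and $F_{\sigma,T}=\{(u,v)\in E(T):\sigma(u)<\sigma(v)\}$; $T$ is transitive if $F_{\sigma,T}=E(T)$ for some ordering $\sigma$. For tournaments $H$ and $T$ let $N^*_T(H)$ be the number of maps $\phi:V(H)\to V(T)$ such that, for all $u,v\in V(H)$, $(u,v)\in E(H)$ if and only if $(\phi(u),\phi(v))\in E(T)$. An $h$-vertex tournament $H$ is globally forcing if for every $\varepsilon>0$ there are $\delta>0$ and $n_0\in\mathbb N$ such that every tournament $T$ on $n\ge n_0$ vertices with $$\left|N^*_T(H)-2^{-\binom h2}n^h\right|\le\delta n^h$$ satisfies $$\left||F_{\sigma,T}|-\tfrac12\tbinom n2\right|\le\varepsilon n^2\quad\text{for every ordering }\sigma\text{ of }T.$$ Proposition. Let $H$ be an $h$-vertex tournament. If $h\ge 7$, then $H$ is globally forcing if and only if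 $H$ is transitive. Moreover, if $h\ge 4$ and $H$ is transitive, then $H$ is globally forcing. -/

import Mathlib

/-- A tournament on the vertex set `V`: a set of ordered pairs (the edges), without loops, such that
for distinct `u`, `v` exactly one of `(u, v)` and `(v, u)` is an edge. -/
structure Tournament (V : Type*) extends Digraph V where
  loopless : ∀ u : V, ¬ Adj u u
  exactly_one : ∀ u v : V, u ≠ v → (Adj u v ↔ ¬ Adj v u)

namespace Tournament

/-- The edge set `E(T)`. -/
def edgeSet {V : Type*} (T : Tournament V) : Set (V × V) :=
  {e | T.Adj e.1 e.2}

/-- `φ` is a labelled embedding of `H` into `T`. (Such a map is automatically injective.) -/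
def IsLabelledEmbedding {W V : Type*} (H : Tournament W) (T : Tournament V) (φ : W → V) : Prop :=
  ∀ u v : W, H.Adj u v ↔ T.Adj (φ u) (φ v)

/-- The number `N*_T(H)` of labelled embeddings of `H` into `T`. -/
noncomputable def embeddingCount {W V : Type*} (H : Tournament W) (T : Tournament V) : ℕ :=
  {φ : W → V | IsLabelledEmbedding H T φ}.ncard

/-- The set `F_{σ,T}` of `σ`-forward edges of `T`, for an ordering `σ` of its vertices. -/
def forwardEdges {V : Type*} [Fintype V] (T : Tournament V) (σ : V ≃ Fin (Fintype.card V)) :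
    Set (V × V) :=
  {e | e ∈ T.edgeSet ∧ σ e.1 < σ e.2}

/-- `T` is transitive: for some ordering, all edges are forward edges. -/
def IsTransitive {V : Type*} [Fintype V] (T : Tournament V) : Prop :=
  ∃ σ : V ≃ Fin (Fintype.card V), T.forwardEdges σ = T.edgeSet

/-- The quasirandomness property with error `ε`: `|F_{σ,T}| = (1/2) (n choose 2) ± ε n²` for every
ordering `σ` of `T`, where `n` is the number of vertices of `T`. -/
def IsQuasirandomWith {V : Type*} [Fintype V] (T : Tournament V) (ε : ℝ) : Prop :=
  ∀ σ : V ≃ Fin (Fintype.card V),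
    |((T.forwardEdges σ).ncard : ℝ) - 1 / 2 * ((Fintype.card V).choose 2 : ℝ)|
      ≤ ε * (Fintype.card V : ℝ) ^ 2

/-- `T` has the correct count of `H` with error `δ`: `N*_T(H) = 2^{-(h choose 2)} n^h ± δ n^h`,
where `h` and `n` are the numbers of vertices of `H` and `T`. -/
def HasCorrectCountWith {W V : Type*} [Fintype W] [Fintype V] (H : Tournament W) (T : Tournament V)
    (δ : ℝ) : Prop :=
  |(embeddingCount H T : ℝ)
      - ((2 : ℝ) ^ (Fintype.card W).choose 2)⁻¹ * (Fintype.card V : ℝ) ^ Fintype.card W|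
    ≤ δ * (Fintype.card V : ℝ) ^ Fintype.card W

/-- `H` is globally forcing: the correct count of `H` implies quasirandomness, i.e. for every
`ε > 0` there are `δ > 0` and `n₀` such that every tournament on `n ≥ n₀` vertices with the
correct count of `H` up to `δ n^h` is quasirandom with error `ε n²`. -/
def IsGloballyForcing {W : Type*} [Fintype W] (H : Tournament W) : Prop :=
  ∀ ε : ℝ, 0 < ε → ∃ δ : ℝ, 0 < δ ∧ ∃ n₀ : ℕ,
    ∀ (V : Type) [Fintype V] (T : Tournament V), n₀ ≤ Fintype.card V →
      HasCorrectCountWith H T δ → T.IsQuasirandomWith ε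

end Tournament

/-! Transitive implies forcing: let $a$ be the adjacency kernel of $T$, with $1/2$ on the diagonal,
and $P_k$ the sum counting transitive $k$-tuples. Conditioning on the dominating vertex and
Cauchy–Schwarz give $P_{k+1}^2\le 2P_kP_{k+2}$ (`transitiveSum_logConvex`), so $2^{\binom
k2}P_k/n^k$ never decreases with $k$. At $k=4$ it is at least $1+E/n^4$, where $E$ is the codegree
energy of $2a-1$ (`card_pow_add_codegreeEnergy_le_transitiveSum`). Hence a nearly correct count for
any $h\ge4$ makes $E$ small, which bounds all cuts of $2a-1$ and then, after slicing an ordering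
into intervals, its forward sum.

Forcing implies transitive: a non-transitive $H$ has no copy in a linear order, while a blow-up of
$H$ with linearly ordered parts has at least $(n/h)^h\ge2^{-\binom h2}n^h$ copies when $h\ge7$.
Changing one tournament into the other vertex by vertex reaches the correct count up to a
lower-order error. Throughout, the first part stays linearly ordered, which rules out
quasirandomness. -/

open Finset

/-! ### Transitive counts in weighted kernels -/

section KernelSums

variable {V : Type*} [Fintype V]

/-- The weighted density sum of the transitive tournament on `k` vertices in the kernel `a`. -/
noncomputable def transitiveSum (a : V → V → ℝ) (k : ℕ) (w : V → ℝ) : ℝ :=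
  ∑ φ : Fin k → V, (∏ i, w (φ i)) * ∏ i, ∏ j, if i < j then a (φ i) (φ j) else 1

lemma transitiveSum_zero (a : V → V → ℝ) (w : V → ℝ) : transitiveSum a 0 w = 1 := by
  simp [transitiveSum]

/-- Vertex $0$ dominates all others, so its adjacencies can be absorbed into their weights. This
recursion is the reason for carrying a weight `w`. -/
lemma transitiveSum_succ (a : V → V → ℝ) (k : ℕ) (w : V → ℝ) :
    transitiveSum a (k + 1) w = ∑ v, w v * transitiveSum a k (fun x => w x * a v x) := by
  unfold transitiveSum
  rw [← (Fin.consEquiv (fun _ : Fin (k + 1) => V)).sum_comp, Fintype.sum_prod_type]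
  refine sum_congr rfl fun v _ => ?_
  rw [mul_sum]
  refine sum_congr rfl fun φ _ => ?_
  simp only [Fin.consEquiv, Equiv.coe_fn_mk, Fin.prod_univ_succ, Fin.cons_zero, Fin.cons_succ,
    Fin.succ_lt_succ_iff, Fin.succ_pos, if_true, if_false, Fin.not_lt_zero, one_mul,
    prod_mul_distrib]
  ring

lemma transitiveSum_nonneg {a : V → V → ℝ} (ha : ∀ u v, 0 ≤ a u v) (k : ℕ) {w : V → ℝ}
    (hw : ∀ v, 0 ≤ w v) : 0 ≤ transitiveSum a k w := by
  refine sum_nonneg fun φ _ => mul_nonneg (prod_nonneg fun i _ => hw _)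
    (prod_nonneg fun i _ => prod_nonneg fun j _ => ?_)
  split_ifs
  exacts [ha _ _, zero_le_one]

lemma transitiveSum_one (a : V → V → ℝ) (w : V → ℝ) : transitiveSum a 1 w = ∑ v, w v := by
  simp [transitiveSum_succ, transitiveSum_zero]

/-- Swapping the two vertices and averaging replaces the kernel by $1/2$; the diagonal value $1/2$
makes this exact. -/
lemma transitiveSum_two {a : V → V → ℝ} (ha : ∀ u v, a u v + a v u = 1) (w : V → ℝ) :
    transitiveSum a 2 w = 1 / 2 * (∑ v, w v) ^ 2 := by
  have h1 : transitiveSum a 2 w = ∑ u, ∑ v, w u * (w v * a u v) := by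
    simp [transitiveSum_succ a 1, transitiveSum_one, mul_sum]
  have h2 : transitiveSum a 2 w = ∑ u, ∑ v, w u * (w v * a v u) := by
    rw [h1, sum_comm]
    exact sum_congr rfl fun u _ => sum_congr rfl fun v _ => by ring
  have h3 : (∑ v, w v) ^ 2 = transitiveSum a 2 w + transitiveSum a 2 w := by
    nth_rewrite 1 [h1]
    rw [h2, sq, sum_mul_sum, ← sum_add_distrib]
    refine sum_congr rfl fun u _ => ?_
    rw [← sum_add_distrib]
    refine sum_congr rfl fun v _ => ?_
    linear_combination (-w u * w v) * ha u v
  linarith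

/-- Induction over all weights at once: the inequality for the out-neighbourhood weights of each
first vertex `v` is summed over `v` by Cauchy–Schwarz. The base case is an equality. -/
lemma transitiveSum_logConvex {a : V → V → ℝ} (h0 : ∀ u v, 0 ≤ a u v)
    (ha : ∀ u v, a u v + a v u = 1) (k : ℕ) {w : V → ℝ} (hw : ∀ v, 0 ≤ w v) :
    transitiveSum a (k + 1) w ^ 2 ≤ 2 * transitiveSum a k w * transitiveSum a (k + 2) w := by
  induction k generalizing w with
  | zero =>
    rw [transitiveSum_zero, transitiveSum_two ha, transitiveSum_one]
    linarith
  | succ k ih =>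
    have hn : ∀ v x, 0 ≤ w x * a v x := fun v x => mul_nonneg (hw x) (h0 v x)
    rw [transitiveSum_succ a (k + 1), transitiveSum_succ a k, transitiveSum_succ a (k + 2),
      mul_sum _ _ (2 : ℝ)]
    refine sum_sq_le_sum_mul_sum_of_sq_le_mul _ (fun v _ => ?_) (fun v _ => ?_) fun v _ => ?_
    · exact mul_nonneg zero_le_two (mul_nonneg (hw v) (transitiveSum_nonneg h0 _ (hn v)))
    · exact mul_nonneg (hw v) (transitiveSum_nonneg h0 _ (hn v))
    · calc _ = w v ^ 2 * transitiveSum a (k + 1) (fun x => w x * a v x) ^ 2 := by ring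
        _ ≤ w v ^ 2 * _ := mul_le_mul_of_nonneg_left (ih (hn v)) (sq_nonneg _)
        _ = _ := by ring

/-- By log-convexity each ratio of consecutive sums is at least half the previous one, and the first
is $n$. Positivity is carried along so that `transitiveSum a k 1` can be cancelled. -/
lemma card_mul_transitiveSum_le [Nonempty V] {a : V → V → ℝ} (h0 : ∀ u v, 0 ≤ a u v)
    (ha : ∀ u v, a u v + a v u = 1) (k : ℕ) :
    0 < transitiveSum a k 1 ∧
      Fintype.card V * transitiveSum a k 1 ≤ 2 ^ k * transitiveSum a (k + 1) 1 := by
  have hpos : (0 : ℝ) < Fintype.card V := by exact_mod_cast Fintype.card_pos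
  induction k with
  | zero => simp [transitiveSum_zero, transitiveSum_one]
  | succ k ih =>
    obtain ⟨hk, hle⟩ := ih
    have hk1 : 0 < transitiveSum a (k + 1) 1 := by
      by_contra hc
      have h1 := mul_pos hpos hk
      have h2 : (2 : ℝ) ^ k * transitiveSum a (k + 1) 1 ≤ 0 :=
        mul_nonpos_of_nonneg_of_nonpos (by positivity) (not_lt.1 hc)
      linarith
    refine ⟨hk1, ?_⟩
    have hlc := transitiveSum_logConvex h0 ha k (w := 1) (fun _ => zero_le_one)
    refine le_of_mul_le_mul_right ?_ hk
    calc _ = transitiveSum a (k + 1) 1 * (Fintype.card V * transitiveSum a k 1) := by ring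
      _ ≤ transitiveSum a (k + 1) 1 * (2 ^ k * transitiveSum a (k + 1) 1) :=
        mul_le_mul_of_nonneg_left hle hk1.le
      _ = 2 ^ k * transitiveSum a (k + 1) 1 ^ 2 := by ring
      _ ≤ 2 ^ k * (2 * transitiveSum a k 1 * transitiveSum a (k + 2) 1) := by gcongr
      _ = _ := by ring

lemma card_pow_mul_transitiveSum_four_le [Nonempty V] {a : V → V → ℝ} (h0 : ∀ u v, 0 ≤ a u v)
    (ha : ∀ u v, a u v + a v u = 1) (k : ℕ) :
    (Fintype.card V : ℝ) ^ k * (64 * transitiveSum a 4 1) ≤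
      2 ^ (4 + k).choose 2 * transitiveSum a (4 + k) 1 := by
  induction k with
  | zero =>
    have : (4 + 0).choose 2 = 6 := rfl
    rw [this]
    norm_num
  | succ k ih =>
    have h := (card_mul_transitiveSum_le h0 ha (4 + k)).2
    have hc : (4 + (k + 1)).choose 2 = (4 + k) + (4 + k).choose 2 := by
      rw [← add_assoc, Nat.choose_succ_succ' _ 1, Nat.choose_one_right]
    calc _ = Fintype.card V * ((Fintype.card V : ℝ) ^ k * (64 * transitiveSum a 4 1)) := by ring
      _ ≤ Fintype.card V * (2 ^ (4 + k).choose 2 * transitiveSum a (4 + k) 1) := by gcongr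
      _ = 2 ^ (4 + k).choose 2 * (Fintype.card V * transitiveSum a (4 + k) 1) := by ring
      _ ≤ 2 ^ (4 + k).choose 2 * (2 ^ (4 + k) * transitiveSum a (4 + k + 1) 1) := by gcongr
      _ = _ := by rw [hc, pow_add, add_assoc]; ring

/-! ### Codegree energy: four-vertex counts, cuts and orderings -/

/-- The squared Frobenius norm of `s sᵀ`. -/
noncomputable def codegreeEnergy (s : V → V → ℝ) : ℝ := ∑ x, ∑ y, (∑ z, s x z * s y z) ^ 2

lemma sum_sum_mul_skew_eq_zero {s : V → V → ℝ} (hs : ∀ x y, s x y = -s y x) (f : V → ℝ) :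
    ∑ x, ∑ y, f x * f y * s x y = 0 := by
  have h : ∑ x, ∑ y, f x * f y * s x y = -∑ x, ∑ y, f x * f y * s x y := by
    conv_lhs => rw [sum_comm]
    rw [← sum_neg_distrib]
    refine sum_congr rfl fun x _ => ?_
    rw [← sum_neg_distrib]
    exact sum_congr rfl fun y _ => by rw [hs y x]; ring
  linarith

/-- With row sums $r$ and codegrees $q$, the inner sum is $n+r_x+r_y+q_{xy}$. On expanding the
square, skewness kills the terms linear in $r$ and the products $rq$; $\sum q$ is a sum of squares
of column sums, so what remains beyond $n^4$ and the energy is nonnegative. -/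
lemma card_pow_add_codegreeEnergy_le {s : V → V → ℝ} (hs : ∀ x y, s x y = -s y x) :
    (Fintype.card V : ℝ) ^ 4 + codegreeEnergy s ≤
      ∑ x, ∑ y, (∑ z, (1 + s x z) * (1 + s y z)) ^ 2 := by
  set n : ℝ := (Fintype.card V : ℝ) with hn
  set r : V → ℝ := fun x => ∑ z, s x z with hr
  set q : V → V → ℝ := fun x y => ∑ z, s x z * s y z with hq
  have hd : ∀ x y, ∑ z, (1 + s x z) * (1 + s y z) = n + r x + r y + q x y := by
    intro x y
    simp only [hr, hq, hn, ← sum_add_distrib, Fintype.card_eq_sum_ones, Nat.cast_sum, Nat.cast_one]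
    exact sum_congr rfl fun z _ => by ring
  have hr0 : ∑ x, r x = 0 := by simpa using sum_sum_mul_skew_eq_zero hs (fun _ => 1)
  have hq0 : 0 ≤ ∑ x, ∑ y, q x y := by
    have : ∑ x, ∑ y, q x y = ∑ z, (∑ x, s x z) ^ 2 := by
      simp only [hq, sq, sum_mul_sum]
      conv_rhs => rw [sum_comm]
      refine sum_congr rfl fun x _ => ?_
      rw [sum_comm]
    rw [this]
    exact sum_nonneg fun _ _ => sq_nonneg _
  have hqs : ∀ x y, q x y = q y x := fun x y => sum_congr rfl fun z _ => mul_comm _ _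
  have hrq : ∑ x, ∑ y, r x * q x y = 0 := by
    have : ∀ x, ∑ y, r x * q x y = -∑ z, r x * r z * s x z := by
      intro x
      simp only [hq, mul_sum]
      rw [sum_comm, ← sum_neg_distrib]
      refine sum_congr rfl fun z _ => ?_
      have : r z = -∑ y, s y z := by
        rw [← sum_neg_distrib]; exact sum_congr rfl fun y _ => hs z y
      rw [this, mul_neg, neg_mul, neg_neg, mul_sum, sum_mul]
      exact sum_congr rfl fun y _ => by ring
    rw [sum_congr rfl fun x _ => this x, sum_neg_distrib, sum_sum_mul_skew_eq_zero hs, neg_zero]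
  have hrq' : ∑ x, ∑ y, r y * q x y = 0 := by
    rw [sum_comm, ← hrq]
    exact sum_congr rfl fun x _ => sum_congr rfl fun y _ => by rw [hqs]
  have key : ∑ x, ∑ y, (n + r x + r y + q x y) ^ 2 = n ^ 4 + codegreeEnergy s
      + ∑ x, ∑ y, (r x + r y) ^ 2 + 2 * n * ∑ x, ∑ y, q x y
      + 2 * ∑ x, ∑ y, r x * q x y + 2 * ∑ x, ∑ y, r y * q x y
      + 2 * n * ∑ x : V, ∑ _y : V, r x + 2 * n * ∑ _x : V, ∑ y : V, r y := by
    have h4 : n ^ 4 = ∑ _x : V, ∑ _y : V, n ^ 2 := by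
      simp only [sum_const, card_univ, nsmul_eq_mul, ← hn]; ring
    rw [h4]
    unfold codegreeEnergy
    simp only [mul_sum, ← sum_add_distrib]
    exact sum_congr rfl fun x _ => sum_congr rfl fun y _ => by ring
  have e1 : ∑ x : V, ∑ _y : V, r x = 0 := by
    rw [sum_comm]; simp [hr0]
  have e2 : ∑ _x : V, ∑ y : V, r y = 0 := by simp [hr0]
  simp only [hd]
  rw [key, hrq, hrq', e1, e2]
  have h5 : 0 ≤ ∑ x, ∑ y, (r x + r y) ^ 2 :=
    sum_nonneg fun _ _ => sum_nonneg fun _ _ => sq_nonneg _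
  have h6 : 0 ≤ 2 * n * ∑ x, ∑ y, q x y := by positivity
  linarith

/-- Fixing the first two vertices leaves a pair in their common out-neighbourhood, contributing half
the squared codegree $d(x,y)^2$. As $d$ is symmetric, the factor $a(x,y)$ averages to $1/2$, so
$64P_4=\sum(4d)^2$. -/
lemma card_pow_add_codegreeEnergy_le_transitiveSum {a : V → V → ℝ}
    (ha : ∀ u v, a u v + a v u = 1) :
    (Fintype.card V : ℝ) ^ 4 + codegreeEnergy (fun x y => 2 * a x y - 1) ≤
      64 * transitiveSum a 4 1 := by
  have hs : ∀ x y, 2 * a x y - 1 = -(2 * a y x - 1) := fun x y => by linarith [ha x y]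
  refine (card_pow_add_codegreeEnergy_le hs).trans_eq ?_
  set d : V → V → ℝ := fun x y => ∑ z, a x z * a y z with hd
  have h1 : ∀ x y, ∑ z, (1 + (2 * a x z - 1)) * (1 + (2 * a y z - 1)) = 4 * d x y := by
    intro x y
    simp only [hd, mul_sum]
    exact sum_congr rfl fun z _ => by ring
  have h2 : transitiveSum a 4 1 = ∑ x, ∑ y, a x y * (1 / 2 * d x y ^ 2) := by
    rw [transitiveSum_succ]
    simp only [transitiveSum_succ a 2, transitiveSum_two ha, Pi.one_apply, one_mul, hd]
  have h3 : transitiveSum a 4 1 = ∑ x, ∑ y, a y x * (1 / 2 * d x y ^ 2) := by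
    rw [h2, sum_comm]
    refine sum_congr rfl fun x _ => sum_congr rfl fun y _ => ?_
    have : d y x = d x y := sum_congr rfl fun z _ => mul_comm _ _
    rw [this]
  have h4 : 2 * transitiveSum a 4 1 = ∑ x, ∑ y, 1 / 2 * d x y ^ 2 := by
    rw [two_mul]
    nth_rewrite 1 [h2]
    rw [h3, ← sum_add_distrib]
    refine sum_congr rfl fun x _ => ?_
    rw [← sum_add_distrib]
    refine sum_congr rfl fun y _ => ?_
    rw [← add_mul, ha, one_mul]
  simp only [h1]
  rw [show 64 * transitiveSum a 4 1 = 32 * (2 * transitiveSum a 4 1) by ring, h4, mul_sum]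
  refine sum_congr rfl fun x _ => ?_
  rw [mul_sum]
  exact sum_congr rfl fun y _ => by ring

/-- Cauchy–Schwarz over `x` removes `f`; a second one, over pairs, removes `g`. Skewness, used
twice, turns column products into row products. -/
lemma sum_cut_pow_four_le {s : V → V → ℝ} (hs : ∀ x y, s x y = -s y x) {f g : V → ℝ}
    (hf : ∀ x, f x ^ 2 ≤ 1) (hg : ∀ x, g x ^ 2 ≤ 1) :
    (∑ x, ∑ y, f x * g y * s x y) ^ 4 ≤ (Fintype.card V : ℝ) ^ 4 * codegreeEnergy s := by
  set n : ℝ := (Fintype.card V : ℝ) with hn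
  have hcard : ∑ _x : V, (1 : ℝ) = n := by simp [hn]
  set t : V → ℝ := fun x => ∑ y, g y * s x y with ht
  set q : V → V → ℝ := fun x y => ∑ z, s x z * s y z with hq
  have h1 : ∑ x, ∑ y, f x * g y * s x y = ∑ x, f x * t x := by
    simp only [ht, mul_sum, mul_assoc]
  have h2 : (∑ x, f x * t x) ^ 2 ≤ n * ∑ x, t x ^ 2 := by
    refine (sum_mul_sq_le_sq_mul_sq _ _ _).trans ?_
    gcongr
    rw [← hcard]
    exact sum_le_sum fun x _ => hf x
  have h3 : ∑ x, t x ^ 2 = ∑ p : V × V, g p.1 * g p.2 * q p.1 p.2 := by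
    rw [Fintype.sum_prod_type]
    simp only [ht, hq, sq, sum_mul_sum]
    simp only [mul_sum]
    rw [sum_comm]
    refine sum_congr rfl fun y _ => ?_
    rw [sum_comm]
    refine sum_congr rfl fun z _ => sum_congr rfl fun x _ => ?_
    rw [hs x y, hs x z]
    ring
  have h4 : (∑ x, t x ^ 2) ^ 2 ≤ n ^ 2 * codegreeEnergy s := by
    rw [h3]
    refine (sum_mul_sq_le_sq_mul_sq _ _ _).trans ?_
    have : ∑ p : V × V, q p.1 p.2 ^ 2 = codegreeEnergy s := by
      rw [Fintype.sum_prod_type]; rfl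
    rw [this]
    gcongr
    · exact sum_nonneg fun _ _ => sum_nonneg fun _ _ => sq_nonneg _
    · rw [← hcard, sq (∑ _x : V, (1 : ℝ)), sum_mul_sum, Fintype.sum_prod_type]
      refine sum_le_sum fun x _ => sum_le_sum fun y _ => ?_
      rw [mul_pow]
      exact mul_le_mul (hg x) (hg y) (sq_nonneg _) zero_le_one
  rw [h1]
  calc (∑ x, f x * t x) ^ 4 = ((∑ x, f x * t x) ^ 2) ^ 2 := by ring
    _ ≤ (n * ∑ x, t x ^ 2) ^ 2 := by gcongr
    _ = n ^ 2 * (∑ x, t x ^ 2) ^ 2 := by ring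
    _ ≤ n ^ 2 * (n ^ 2 * codegreeEnergy s) := by gcongr
    _ = _ := by ring

lemma abs_sum_cut_le {s : V → V → ℝ} (hs : ∀ x y, s x y = -s y x) {η : ℝ} (hη : 0 ≤ η)
    (hQ : codegreeEnergy s ≤ η ^ 4 * (Fintype.card V : ℝ) ^ 4) {f g : V → ℝ}
    (hf : ∀ x, f x ^ 2 ≤ 1) (hg : ∀ x, g x ^ 2 ≤ 1) :
    |∑ x, ∑ y, f x * g y * s x y| ≤ η * (Fintype.card V : ℝ) ^ 2 := by
  refine abs_le_of_sq_le_sq ?_ (by positivity)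
  refine le_of_sq_le_sq ?_ (by positivity)
  calc _ = (∑ x, ∑ y, f x * g y * s x y) ^ 4 := by ring
    _ ≤ _ := sum_cut_pow_four_le hs hf hg
    _ ≤ (Fintype.card V : ℝ) ^ 4 * (η ^ 4 * (Fintype.card V : ℝ) ^ 4) := by gcongr
    _ = _ := by ring

/-- For a skew kernel with small codegree energy, the sum over the pairs that are increasing in
a given order is small: the order is cut into intervals of length `m`. -/
lemma abs_sum_forward_le {s : V → V → ℝ} (hs : ∀ x y, s x y = -s y x) (hs1 : ∀ x y, |s x y| ≤ 1)
    {η : ℝ} (hη : 0 ≤ η) (hQ : codegreeEnergy s ≤ η ^ 4 * (Fintype.card V : ℝ) ^ 4)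
    {n : ℕ} (hn : Fintype.card V = n) (σ : V ≃ Fin n) {m : ℕ} (hm : 0 < m) :
    |∑ x, ∑ y, if σ x < σ y then s x y else 0| ≤
      ((n / m + 1 : ℕ) : ℝ) * (η * (n : ℝ) ^ 2) + (n : ℝ) * m := by
  set b : V → ℕ := fun x => (σ x : ℕ) / m with hb
  have hbK : ∀ x, b x < n / m + 1 := fun x =>
    Nat.lt_succ_of_le (Nat.div_le_div_right (σ x).2.le)
  have hmono : ∀ x y, b x < b y → σ x < σ y := by
    intro x y h
    by_contra hc
    exact absurd (Nat.div_le_div_right (c := m) (Fin.le_def.1 (not_lt.1 hc))) (not_le.2 h)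
  -- Pairs in different intervals split into cuts "interval `k` against all later ones"; pairs in
  -- the same interval are bounded trivially.
  have hsplit : ∀ x y, (if σ x < σ y then s x y else 0) =
      (∑ k ∈ range (n / m + 1),
        (if b x = k then (1 : ℝ) else 0) * (if k < b y then (1 : ℝ) else 0) * s x y)
      + if b x = b y ∧ σ x < σ y then s x y else 0 := by
    intro x y
    have : ∑ k ∈ range (n / m + 1),
        (if b x = k then (1 : ℝ) else 0) * (if k < b y then (1 : ℝ) else 0) * s x y =
        if b x < b y then s x y else 0 := by
      rw [sum_eq_single (b x)]
      · simp
      · intro k _ hk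
        simp [hk.symm]
      · intro h
        exact absurd (mem_range.2 (hbK x)) h
    rw [this]
    rcases lt_trichotomy (b x) (b y) with h | h | h
    · simp [h, h.ne, hmono x y h]
    · simp [h]
    · simp [h.not_gt, h.ne', (hmono y x h).not_gt]
  have hsum : ∑ x, ∑ y, (if σ x < σ y then s x y else 0) =
      (∑ k ∈ range (n / m + 1), ∑ x, ∑ y,
        (if b x = k then (1 : ℝ) else 0) * (if k < b y then (1 : ℝ) else 0) * s x y)
      + ∑ x, ∑ y, if b x = b y ∧ σ x < σ y then s x y else 0 := by
    simp only [hsplit, sum_add_distrib]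
    congr 1
    conv_rhs => rw [sum_comm]
    refine sum_congr rfl fun x _ => ?_
    rw [sum_comm]
  rw [hsum]
  refine (abs_add_le _ _).trans (add_le_add ?_ ?_)
  · rw [← hn]
    refine (abs_sum_le_sum_abs _ _).trans ?_
    refine (sum_le_card_nsmul _ _ (η * (Fintype.card V : ℝ) ^ 2) fun k _ => ?_).trans_eq ?_
    · refine abs_sum_cut_le hs hη hQ (f := fun x => if b x = k then (1 : ℝ) else 0)
        (g := fun y => if k < b y then (1 : ℝ) else 0) (fun x => ?_) (fun x => ?_) <;>
      · split_ifs <;> norm_num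
    · rw [card_range, nsmul_eq_mul]
  · refine (abs_sum_le_sum_abs _ _).trans ?_
    refine (sum_le_card_nsmul _ _ (m : ℝ) fun x _ => ?_).trans_eq ?_
    · refine (abs_sum_le_sum_abs _ _).trans ?_
      have hblock : #{y | b y = b x} ≤ m := by
        have : #{y | b y = b x} ≤ #(Ico (b x * m) (b x * m + m)) := by
          refine card_le_card_of_injOn (fun y => (σ y : ℕ)) (fun y hy => ?_) ?_
          · have hy' : (σ y : ℕ) / m = b x := by simpa using hy
            have h1 := Nat.div_add_mod (σ y : ℕ) m
            have h2 := Nat.mod_lt (σ y : ℕ) hm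
            rw [hy', mul_comm] at h1
            simp only [coe_Ico, Set.mem_Ico]
            omega
          · intro y _ z _ h
            exact σ.injective (Fin.ext h)
        simpa using this
      calc _ ≤ ∑ y, if b y = b x then (1 : ℝ) else 0 := by
            refine sum_le_sum fun y _ => ?_
            by_cases h : b x = b y ∧ σ x < σ y
            · rw [if_pos h, if_pos h.1.symm]
              exact hs1 x y
            · rw [if_neg h, abs_zero]
              split_ifs <;> norm_num
        _ = (#{y | b y = b x} : ℝ) := by simp
        _ ≤ m := by exact_mod_cast hblock
    · rw [card_univ, nsmul_eq_mul, hn]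

end KernelSums

/-! ### Counting non-injective maps (multiplied by $n$, to avoid the exponent $k-1$) -/

lemma pow_le_descFactorial_add (n k : ℕ) :
    n ^ (k + 1) ≤ n.descFactorial k * n + k ^ 2 * n ^ k := by
  induction k with
  | zero => simp
  | succ k ih =>
    have h1 : n * n.descFactorial k ≤ n.descFactorial (k + 1) + k * n ^ k := by
      rw [Nat.descFactorial_succ]
      have : n ≤ (n - k) + k := by omega
      calc n * n.descFactorial k ≤ ((n - k) + k) * n.descFactorial k := by gcongr
        _ = (n - k) * n.descFactorial k + k * n.descFactorial k := by ring
        _ ≤ _ := by gcongr; exact Nat.descFactorial_le_pow n k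
    calc n ^ (k + 1 + 1) = n ^ (k + 1) * n := pow_succ _ _
      _ ≤ (n.descFactorial k * n + k ^ 2 * n ^ k) * n := by gcongr
      _ = (n * n.descFactorial k) * n + k ^ 2 * n ^ (k + 1) := by ring
      _ ≤ (n.descFactorial (k + 1) + k * n ^ k) * n + k ^ 2 * n ^ (k + 1) := by gcongr
      _ = n.descFactorial (k + 1) * n + (k ^ 2 + k) * n ^ (k + 1) := by ring
      _ ≤ _ := by gcongr; nlinarith

lemma card_not_injective_mul_le {V : Type*} [Fintype V] [DecidableEq V] (k : ℕ) :
    #{φ : Fin k → V | ¬ Function.Injective φ} * Fintype.card V ≤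
      k ^ 2 * Fintype.card V ^ k := by
  have h1 : #{φ : Fin k → V | Function.Injective φ} = (Fintype.card V).descFactorial k := by
    have h := Fintype.card_embedding_eq (α := Fin k) (β := V)
    rw [Fintype.card_fin] at h
    rw [← h, ← Fintype.card_subtype]
    exact Fintype.card_congr (Equiv.subtypeInjectiveEquivEmbedding _ _)
  have h2 := card_filter_add_card_filter_not (s := (univ : Finset (Fin k → V)))
    (fun φ => Function.Injective φ)
  rw [h1, card_univ, Fintype.card_fun, Fintype.card_fin] at h2
  have h3 := pow_le_descFactorial_add (Fintype.card V) k
  rw [pow_succ, ← h2, add_mul] at h3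
  rw [← h2]
  omega

/-! ### From kernels to tournaments: transitive tournaments are forcing -/

namespace Tournament

variable {V W : Type*}

lemma adj_asymm (T : Tournament V) {u v : V} (h : T.Adj u v) : ¬ T.Adj v u := by
  rcases eq_or_ne u v with rfl | hne
  · exact T.loopless u
  · exact (T.exactly_one u v hne).1 h

lemma IsLabelledEmbedding.injective {H : Tournament W} {T : Tournament V} {φ : W → V}
    (h : IsLabelledEmbedding H T φ) : Function.Injective φ := by
  intro u v huv
  by_contra hne
  by_cases hH : H.Adj u v
  · exact T.loopless _ (huv ▸ (h u v).1 hH)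
  · have := (H.exactly_one v u (Ne.symm hne)).2 hH
    exact T.loopless _ (huv ▸ (h v u).1 this)

open Classical in
lemma embeddingCount_eq_card [Fintype W] [Fintype V] (H : Tournament W) (T : Tournament V) :
    embeddingCount H T = #{φ : W → V | IsLabelledEmbedding H T φ} := by
  rw [embeddingCount, Set.ncard_eq_toFinset_card', Set.toFinset_ofPred]

lemma IsTransitive.exists_adj_iff [Fintype W] {H : Tournament W} (h : H.IsTransitive) :
    ∃ σ : W ≃ Fin (Fintype.card W), ∀ u v, H.Adj u v ↔ σ u < σ v := by
  obtain ⟨σ, hσ⟩ := h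
  have h1 : ∀ u v, H.Adj u v → σ u < σ v := fun u v huv => by
    have : (u, v) ∈ H.forwardEdges σ := hσ ▸ huv
    exact this.2
  refine ⟨σ, fun u v => ⟨h1 u v, fun hlt => ?_⟩⟩
  have hne : u ≠ v := fun h => by simp [h] at hlt
  exact (H.exactly_one u v hne).2 fun hvu => lt_asymm hlt (h1 v u hvu)

open Classical in
/-- The `0/1` adjacency kernel of `T`, with value `1/2` on the diagonal. -/
noncomputable def kernel (T : Tournament V) (u v : V) : ℝ :=
  if u = v then 1 / 2 else if T.Adj u v then 1 else 0

lemma kernel_nonneg (T : Tournament V) (u v : V) : 0 ≤ T.kernel u v := by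
  unfold kernel; split_ifs <;> norm_num

lemma kernel_le_one (T : Tournament V) (u v : V) : T.kernel u v ≤ 1 := by
  unfold kernel; split_ifs <;> norm_num

lemma kernel_add_swap (T : Tournament V) (u v : V) : T.kernel u v + T.kernel v u = 1 := by
  unfold kernel
  rcases eq_or_ne u v with rfl | hne
  · norm_num
  · have := T.exactly_one u v hne
    by_cases h : T.Adj u v <;> by_cases h' : T.Adj v u <;> simp_all [hne.symm]

/-- On injective maps the product is the indicator of an embedding; the diagonal value matters only
on non-injective maps, each contributing at most $1$. -/
lemma transitiveSum_kernel_le [Fintype W] [Fintype V] {H : Tournament W} (T : Tournament V)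
    {h : ℕ} (e : W ≃ Fin h) (he : ∀ u v, H.Adj u v ↔ e u < e v) :
    transitiveSum T.kernel h 1 * Fintype.card V ≤
      (embeddingCount H T : ℝ) * Fintype.card V + (h : ℝ) ^ 2 * (Fintype.card V : ℝ) ^ h := by
  classical
  set E : Finset (Fin h → V) := {φ | ∀ i j, i < j → T.Adj (φ i) (φ j)} with hE
  have h1 : transitiveSum T.kernel h 1 ≤
      (#E : ℝ) + (#{φ : Fin h → V | ¬ Function.Injective φ} : ℝ) := by
    have : (#E : ℝ) + (#{φ : Fin h → V | ¬ Function.Injective φ} : ℝ) =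
        ∑ φ : Fin h → V, ((if ∀ i j, i < j → T.Adj (φ i) (φ j) then (1 : ℝ) else 0)
          + if ¬ Function.Injective φ then (1 : ℝ) else 0) := by
      rw [sum_add_distrib, sum_boole, sum_boole]
    rw [this]
    refine sum_le_sum fun φ _ => ?_
    simp only [Pi.one_apply, prod_const_one, one_mul]
    have hterm0 : ∀ i j, 0 ≤ if i < j then T.kernel (φ i) (φ j) else 1 := fun i j => by
      split_ifs
      exacts [T.kernel_nonneg _ _, zero_le_one]
    have hterm1 : ∀ i j, (if i < j then T.kernel (φ i) (φ j) else 1) ≤ 1 := fun i j => by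
      split_ifs
      exacts [T.kernel_le_one _ _, le_rfl]
    have hle1 : (∏ i, ∏ j, if i < j then T.kernel (φ i) (φ j) else 1) ≤ 1 :=
      prod_le_one (fun i _ => prod_nonneg fun j _ => hterm0 i j) fun i _ =>
        prod_le_one (fun j _ => hterm0 i j) fun j _ => hterm1 i j
    by_cases hinj : Function.Injective φ
    · by_cases hemb : ∀ i j, i < j → T.Adj (φ i) (φ j)
      · rw [if_pos hemb, if_neg (not_not.2 hinj), add_zero]
        exact hle1
      · rw [if_neg hemb, if_neg (not_not.2 hinj), add_zero]
        push Not at hemb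
        obtain ⟨i, j, hij, hadj⟩ := hemb
        refine le_of_eq (prod_eq_zero (mem_univ i) (prod_eq_zero (mem_univ j) ?_))
        rw [if_pos hij, kernel, if_neg (fun hh => hij.ne (hinj hh)), if_neg hadj]
    · rw [if_pos hinj]
      refine hle1.trans ?_
      split_ifs <;> norm_num
  have h2 : #E ≤ embeddingCount H T := by
    rw [embeddingCount_eq_card]
    refine card_le_card_of_injOn (fun φ => φ ∘ e) (fun φ hφ => ?_) fun φ _ ψ _ hφψ =>
      e.surjective.injective_comp_right hφψ
    have hφ' : ∀ i j, i < j → T.Adj (φ i) (φ j) := by simpa [hE] using hφ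
    have : IsLabelledEmbedding H T (φ ∘ e) := by
      intro u v
      rw [he]
      refine ⟨hφ' _ _, fun hadj => ?_⟩
      by_contra hc
      rcases (not_lt.1 hc).eq_or_lt with heq | hlt
      · simp only [Function.comp_apply, heq] at hadj
        exact T.loopless _ hadj
      · exact T.adj_asymm hadj (hφ' _ _ hlt)
    simpa using this
  have h3 : (#{φ : Fin h → V | ¬ Function.Injective φ} : ℝ) * Fintype.card V ≤
      (h : ℝ) ^ 2 * (Fintype.card V : ℝ) ^ h := by
    exact_mod_cast card_not_injective_mul_le (V := V) h
  have h2' : (#E : ℝ) ≤ embeddingCount H T := by exact_mod_cast h2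
  have hn : (0 : ℝ) ≤ Fintype.card V := Nat.cast_nonneg _
  calc _ ≤ ((#E : ℝ) + (#{φ : Fin h → V | ¬ Function.Injective φ} : ℝ)) * Fintype.card V := by
        gcongr
    _ = (#E : ℝ) * Fintype.card V
        + (#{φ : Fin h → V | ¬ Function.Injective φ} : ℝ) * Fintype.card V := by ring
    _ ≤ _ := by gcongr

lemma sum_lt_equiv_eq_choose [Fintype V] {n : ℕ} (σ : V ≃ Fin n) :
    (∑ x, ∑ y, if σ x < σ y then (1 : ℝ) else 0) = (n.choose 2 : ℝ) := by
  have h1 : (∑ x, ∑ y, if σ x < σ y then (1 : ℝ) else 0) =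
      ∑ i : Fin n, ∑ j : Fin n, if i < j then (1 : ℝ) else 0 := by
    rw [← σ.sum_comp]
    exact sum_congr rfl fun x _ => σ.sum_comp (fun j => if σ x < j then (1 : ℝ) else 0)
  have h2 : (∑ i : Fin n, ∑ j : Fin n, if i < j then (1 : ℝ) else 0) =
      ∑ i : Fin n, ∑ j : Fin n, if j < i then (1 : ℝ) else 0 := sum_comm
  have h3 : (∑ i : Fin n, ∑ j : Fin n, if i < j then (1 : ℝ) else 0)
      + (∑ i : Fin n, ∑ j : Fin n, if j < i then (1 : ℝ) else 0)
      + (∑ i : Fin n, ∑ j : Fin n, if i = j then (1 : ℝ) else 0) = (n : ℝ) ^ 2 := by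
    have : (n : ℝ) ^ 2 = ∑ _i : Fin n, ∑ _j : Fin n, (1 : ℝ) := by simp [sq]
    rw [this]
    simp only [← sum_add_distrib]
    refine sum_congr rfl fun i _ => sum_congr rfl fun j _ => ?_
    rcases lt_trichotomy i j with h | h | h
    · simp [h, h.not_gt, h.ne]
    · simp [h]
    · simp [h, h.not_gt, h.ne']
  have h4 : (∑ i : Fin n, ∑ j : Fin n, if i = j then (1 : ℝ) else 0) = n := by simp
  rw [h1, Nat.cast_choose_two]
  rw [← h2, h4] at h3
  linarith

lemma forwardEdges_ncard_sub [Fintype V] (T : Tournament V) (σ : V ≃ Fin (Fintype.card V)) :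
    ((T.forwardEdges σ).ncard : ℝ) - 1 / 2 * ((Fintype.card V).choose 2 : ℝ) =
      1 / 2 * ∑ x, ∑ y, if σ x < σ y then 2 * T.kernel x y - 1 else 0 := by
  classical
  have h1 : ((T.forwardEdges σ).ncard : ℝ) =
      ∑ x, ∑ y, if T.Adj x y ∧ σ x < σ y then (1 : ℝ) else 0 := by
    rw [← Fintype.sum_prod_type' (f := fun x y => if T.Adj x y ∧ σ x < σ y then (1 : ℝ) else 0),
      sum_boole, Set.ncard_eq_toFinset_card', forwardEdges, edgeSet, Set.toFinset_ofPred]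
    rfl
  rw [h1, ← sum_lt_equiv_eq_choose σ]
  simp only [mul_sum, ← sum_sub_distrib]
  refine sum_congr rfl fun x _ => sum_congr rfl fun y _ => ?_
  by_cases h : σ x < σ y
  · have hne : x ≠ y := fun hh => by simp [hh] at h
    by_cases hadj : T.Adj x y <;> simp [kernel, h, hne, hadj]; norm_num
  · simp [h]

lemma isQuasirandomWith_of_codegreeEnergy_le {ε : ℝ} (hε : 0 < ε) :
    ∃ ρ : ℝ, 0 < ρ ∧ ∃ n₀ : ℕ, ∀ (V : Type*) [Fintype V] (T : Tournament V),
      n₀ ≤ Fintype.card V →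
      codegreeEnergy (fun x y => 2 * T.kernel x y - 1) ≤ ρ * (Fintype.card V : ℝ) ^ 4 →
      T.IsQuasirandomWith ε := by
  -- Intervals of length `n / M + 1`: there are at most $M+1$, so by the choice of `η` the cuts cost
  -- at most $\varepsilon n^2/2$. As $n\ge M>2/\varepsilon$, pairs inside intervals cost at most
  -- $\varepsilon n^2$. The factor $1/2$ in `forwardEdges_ncard_sub` absorbs the total.
  obtain ⟨M, hM⟩ := exists_nat_gt (2 / ε)
  have hM0 : (0 : ℝ) < M := (by positivity : (0 : ℝ) < 2 / ε).trans hM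
  have hM1 : 0 < M := by exact_mod_cast hM0
  set η : ℝ := ε / (2 * (M + 1)) with hη
  have hη0 : 0 < η := by positivity
  refine ⟨η ^ 4, by positivity, M, fun V _ T hn hQ σ => ?_⟩
  have hs : ∀ x y, 2 * T.kernel x y - 1 = -(2 * T.kernel y x - 1) := fun x y => by
    linarith [T.kernel_add_swap x y]
  have hs1 : ∀ x y, |2 * T.kernel x y - 1| ≤ 1 := fun x y => by
    rw [abs_le]
    constructor <;> linarith [T.kernel_nonneg x y, T.kernel_le_one x y]
  have hbound := abs_sum_forward_le hs hs1 hη0.le hQ rfl σ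
    (Nat.succ_pos (Fintype.card V / M))
  rw [forwardEdges_ncard_sub, abs_mul, abs_of_pos (by norm_num : (0 : ℝ) < 1 / 2)]
  generalize (∑ x, ∑ y, if σ x < σ y then 2 * T.kernel x y - 1 else 0) = S at hbound ⊢
  generalize Fintype.card V = n at hn hbound ⊢
  have hK : n / (n / M + 1) < M + 1 := by
    refine Nat.lt_succ_of_le (Nat.div_le_of_le_mul ?_)
    have := Nat.div_add_mod n M
    have := Nat.mod_lt n hM1
    nlinarith
  have hK' : ((n / (n / M + 1) + 1 : ℕ) : ℝ) ≤ M + 1 := by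
    have : n / (n / M + 1) + 1 ≤ M + 1 := hK
    exact_mod_cast this
  have hm' : ((n / M + 1 : ℕ) : ℝ) ≤ ε * n := by
    have h1 : ((n / M : ℕ) : ℝ) ≤ n / M := Nat.cast_div_le
    have h2 : (1 : ℝ) ≤ n / M := (one_le_div hM0).2 (by exact_mod_cast hn)
    have h3 : (n : ℝ) / M ≤ ε / 2 * n := by
      rw [div_le_iff₀ hM0]
      rw [div_lt_iff₀ hε] at hM
      have : (0 : ℝ) ≤ n := Nat.cast_nonneg _
      nlinarith
    push_cast
    linarith
  have hfirst : ((n / (n / M + 1) + 1 : ℕ) : ℝ) * (η * (n : ℝ) ^ 2) ≤ ε / 2 * (n : ℝ) ^ 2 := by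
    calc _ ≤ ((M : ℝ) + 1) * (η * (n : ℝ) ^ 2) := by gcongr
      _ = _ := by rw [hη]; field_simp
  have hsecond : (n : ℝ) * ((n / M + 1 : ℕ) : ℝ) ≤ ε * (n : ℝ) ^ 2 := by
    calc _ ≤ (n : ℝ) * (ε * n) := by gcongr
      _ = _ := by ring
  have hpos : 0 ≤ ε * (n : ℝ) ^ 2 := by positivity
  have hb2 := hbound.trans (add_le_add hfirst hsecond)
  linarith

theorem IsTransitive.isGloballyForcing [Fintype W] {H : Tournament W} (hH : H.IsTransitive)
    (hW : 4 ≤ Fintype.card W) : H.IsGloballyForcing := by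
  intro ε hε
  obtain ⟨ρ, hρ, n₁, hqr⟩ := isQuasirandomWith_of_codegreeEnergy_le hε
  set h := Fintype.card W with hh
  obtain ⟨e, he⟩ : ∃ e : W ≃ Fin h, ∀ u v, H.Adj u v ↔ e u < e v := hH.exists_adj_iff
  obtain ⟨k, hk⟩ := Nat.exists_eq_add_of_le hW
  set C : ℝ := (2 : ℝ) ^ h.choose 2 with hC
  have hC0 : 0 < C := by positivity
  obtain ⟨n₂, hn₂⟩ := exists_nat_gt (2 * C * (h : ℝ) ^ 2 / ρ)
  -- Half of `ρ` pays for the count error, the other half, through `n₂`, for the non-injective maps.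
  refine ⟨ρ / (2 * C), by positivity, max n₁ (max n₂ 1), fun V _ T hn hcount => ?_⟩
  have hn1 : n₁ ≤ Fintype.card V := (le_max_left _ _).trans hn
  have hn2 : n₂ ≤ Fintype.card V := ((le_max_left _ _).trans (le_max_right _ _)).trans hn
  have hn3 : 1 ≤ Fintype.card V := ((le_max_right _ _).trans (le_max_right _ _)).trans hn
  refine hqr V T hn1 ?_
  have : Nonempty V := Fintype.card_pos_iff.1 hn3
  have hcount' := (abs_le.1 hcount).2
  rw [← hh, ← hC] at hcount'
  have hsum := transitiveSum_kernel_le T e he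
  have hlow := card_pow_mul_transitiveSum_four_le T.kernel_nonneg T.kernel_add_swap k
  rw [← hk, ← hC] at hlow
  have hQ := card_pow_add_codegreeEnergy_le_transitiveSum T.kernel_add_swap
  set n : ℝ := (Fintype.card V : ℝ) with hnV
  have hn0 : 0 < n := by rw [hnV]; exact_mod_cast hn3
  set P := transitiveSum T.kernel h 1
  set Q := codegreeEnergy (fun x y => 2 * T.kernel x y - 1)
  set N : ℝ := (embeddingCount H T : ℝ)
  have hnbig : 2 * C * (h : ℝ) ^ 2 ≤ ρ * n := by
    rw [div_lt_iff₀ hρ] at hn₂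
    have : (n₂ : ℝ) ≤ n := by rw [hnV]; exact_mod_cast hn2
    nlinarith
  have hCP : C * P ≤ n ^ h + ρ * n ^ h := by
    refine le_of_mul_le_mul_right ?_ hn0
    have h1 : C * N ≤ n ^ h + ρ / 2 * n ^ h := by
      have h2 : N ≤ C⁻¹ * n ^ h + ρ / (2 * C) * n ^ h := by linarith
      calc C * N ≤ C * (C⁻¹ * n ^ h + ρ / (2 * C) * n ^ h) := by gcongr
        _ = _ := by field_simp
    calc C * P * n = C * (P * n) := by ring
      _ ≤ C * (N * n + (h : ℝ) ^ 2 * n ^ h) := by gcongr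
      _ = C * N * n + (2 * C * (h : ℝ) ^ 2) * n ^ h / 2 := by ring
      _ ≤ (n ^ h + ρ / 2 * n ^ h) * n + (ρ * n) * n ^ h / 2 := by gcongr
      _ = _ := by ring
  have hfin : n ^ k * (n ^ 4 + Q) ≤ n ^ k * (n ^ 4 + ρ * n ^ 4) := by
    calc n ^ k * (n ^ 4 + Q) ≤ n ^ k * (64 * transitiveSum T.kernel 4 1) := by gcongr
      _ ≤ C * P := hlow
      _ ≤ n ^ h + ρ * n ^ h := hCP
      _ = _ := by rw [hk, pow_add]; ring
  have := le_of_mul_le_mul_left hfin (by positivity)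
  linarith

end Tournament

/-! ### Non-transitive tournaments on at least seven vertices are not forcing -/

namespace Tournament

variable {V W : Type*}

/-- The tournament of a linear order. -/
def ofLinearOrder (V : Type*) [LinearOrder V] : Tournament V where
  Adj := (· < ·)
  loopless := lt_irrefl
  exactly_one _ _ h := ⟨fun h' => h'.not_gt, fun h' => lt_of_le_of_ne (not_lt.1 h') h⟩

/-- The blow-up of `H` along `b : V → W`, with the linear order of `V` inside the fibres. -/
def blowUp [LinearOrder V] (H : Tournament W) (b : V → W) : Tournament V where
  Adj u v := (b u = b v ∧ u < v) ∨ (b u ≠ b v ∧ H.Adj (b u) (b v))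
  loopless u := by simp
  exactly_one u v h := by
    by_cases hb : b u = b v
    · simp only [hb, ne_eq, not_true_eq_false, false_and, or_false, true_and]
      exact (ofLinearOrder V).exactly_one u v h
    · simpa [hb, Ne.symm hb] using H.exactly_one _ _ hb

/-- The tournament that agrees with `T₁` inside `S` and with `T₀` on all other pairs. -/
def splice (T₀ T₁ : Tournament V) (S : Finset V) : Tournament V where
  Adj u v := ((u ∈ S ∧ v ∈ S) ∧ T₁.Adj u v) ∨ (¬(u ∈ S ∧ v ∈ S) ∧ T₀.Adj u v)
  loopless u := by simp [T₀.loopless, T₁.loopless]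
  exactly_one u v h := by
    by_cases hS : u ∈ S ∧ v ∈ S
    · simpa [hS] using T₁.exactly_one u v h
    · have hS' : ¬(v ∈ S ∧ u ∈ S) := fun h => hS h.symm
      simpa only [hS, hS', false_and, false_or, not_false_eq_true, true_and]
        using T₀.exactly_one u v h

lemma isTransitive_of_embedding [Fintype W] [LinearOrder V] {H : Tournament W} {φ : W → V}
    (h : IsLabelledEmbedding H (ofLinearOrder V) φ) : H.IsTransitive := by
  let _ : LinearOrder W := LinearOrder.lift' φ h.injective
  let o := (univ : Finset W).orderIsoOfFin card_univ
  refine ⟨(Equiv.subtypeUnivEquiv (p := fun x => x ∈ (univ : Finset W)) mem_univ).symm.trans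
    o.symm.toEquiv, ?_⟩
  ext ⟨u, v⟩
  refine ⟨fun huv => huv.1, fun huv => ⟨huv, ?_⟩⟩
  exact o.symm.lt_iff_lt.2 ((h u v).1 huv)

lemma card_apply_eq_mul [Fintype W] [Fintype V] [DecidableEq W] [DecidableEq V] (i : W) (x : V) :
    #{φ : W → V | φ i = x} * Fintype.card V = Fintype.card V ^ Fintype.card W := by
  have h1 : ({φ : W → V | φ i = x} : Finset (W → V)) =
      Fintype.piFinset fun k => if k = i then {x} else univ := by
    ext φ
    simp only [mem_filter, mem_univ, true_and, Fintype.mem_piFinset]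
    refine ⟨fun h k => ?_, fun h => by simpa using h i⟩
    split_ifs with hk
    · simp [hk, h]
    · exact mem_univ _
  have h2 : ∏ k ∈ univ.erase i, #(if k = i then {x} else (univ : Finset V)) =
      Fintype.card V ^ (Fintype.card W - 1) := by
    rw [prod_congr rfl (g := fun _ => Fintype.card V) fun k hk => by
      rw [if_neg (ne_of_mem_erase hk), card_univ], prod_const, card_erase_of_mem (mem_univ i),
      card_univ]
  rw [h1, Fintype.card_piFinset, ← mul_prod_erase _ _ (mem_univ i), h2, if_pos rfl,
    card_singleton, one_mul, ← pow_succ,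
    Nat.sub_add_cancel (Fintype.card_pos_iff.2 ⟨i⟩)]

/-- Only maps hitting `x` can be affected, and each vertex of `H` is sent to `x` by $n^{h-1}$ maps.
-/
lemma embeddingCount_le_of_agree_off [Fintype W] [Fintype V] (H : Tournament W)
    {T T' : Tournament V} (x : V) (h : ∀ u v, u ≠ x → v ≠ x → (T.Adj u v ↔ T'.Adj u v)) :
    embeddingCount H T * Fintype.card V ≤ embeddingCount H T' * Fintype.card V
      + Fintype.card W * Fintype.card V ^ Fintype.card W := by
  classical
  have h1 : embeddingCount H T ≤ embeddingCount H T' + ∑ i, #{φ : W → V | φ i = x} := by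
    rw [embeddingCount_eq_card, embeddingCount_eq_card]
    refine (card_le_card (t := _ ∪ univ.biUnion fun i => {φ : W → V | φ i = x})
      fun φ hφ => ?_).trans ((card_union_le _ _).trans
        (Nat.add_le_add_left card_biUnion_le _))
    simp only [mem_filter, mem_univ, true_and, mem_union, mem_biUnion] at hφ ⊢
    by_cases hx : ∃ i, φ i = x
    · exact Or.inr hx
    · push Not at hx
      exact Or.inl fun u v => (hφ u v).trans (h _ _ (hx u) (hx v))
  calc _ ≤ (embeddingCount H T' + ∑ i, #{φ : W → V | φ i = x}) * Fintype.card V := by gcongr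
    _ = _ := by rw [add_mul, sum_mul, sum_congr rfl fun i _ => card_apply_eq_mul i x]; simp

/-- Interpolating one vertex at a time, the embedding count attains each intermediate value up to
a lower-order error. -/
lemma exists_splice_embeddingCount_near [Fintype W] [Fintype V] (H : Tournament W)
    (T₀ T₁ : Tournament V) {c : ℝ} (h0 : (embeddingCount H T₀ : ℝ) ≤ c)
    (h1 : c ≤ embeddingCount H T₁) :
    ∃ S : Finset V, |(embeddingCount H (splice T₀ T₁ S) : ℝ) - c| * Fintype.card V ≤
      Fintype.card W * (Fintype.card V : ℝ) ^ Fintype.card W := by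
  classical
  have hn : (0 : ℝ) ≤ Fintype.card V := Nat.cast_nonneg _
  -- Either the count has not yet exceeded `c`, or it has crossed `c` in a single small step, which
  -- supplies the witness.
  have key : ∀ S : Finset V, (embeddingCount H (splice T₀ T₁ S) : ℝ) ≤ c ∨
      ∃ S : Finset V, |(embeddingCount H (splice T₀ T₁ S) : ℝ) - c| * Fintype.card V ≤
        Fintype.card W * (Fintype.card V : ℝ) ^ Fintype.card W := by
    intro S
    induction S using Finset.induction_on with
    | empty =>
      left
      have : splice T₀ T₁ ∅ = T₀ := by
        rcases T₀ with ⟨⟨A⟩, _, _⟩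
        simp [splice]
      rwa [this]
    | insert x S _ ih =>
      rcases ih with ih | ih
      · rcases le_or_gt (embeddingCount H (splice T₀ T₁ (insert x S)) : ℝ) c with hc | hc
        · exact Or.inl hc
        · refine Or.inr ⟨insert x S, ?_⟩
          have hstep := embeddingCount_le_of_agree_off H (T := splice T₀ T₁ (insert x S))
            (T' := splice T₀ T₁ S) x fun u v hu hv => by simp [splice, hu, hv]
          have hstep' : (embeddingCount H (splice T₀ T₁ (insert x S)) : ℝ) * Fintype.card V ≤
              (embeddingCount H (splice T₀ T₁ S) : ℝ) * Fintype.card V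
              + Fintype.card W * (Fintype.card V : ℝ) ^ Fintype.card W := by exact_mod_cast hstep
          rw [abs_of_pos (sub_pos.2 hc)]
          nlinarith
      · exact Or.inr ih
  rcases key univ with h | h
  · refine ⟨univ, ?_⟩
    have : splice T₀ T₁ univ = T₁ := by
      rcases T₁ with ⟨⟨A⟩, _, _⟩
      simp [splice]
    rw [this] at h ⊢
    rw [le_antisymm h h1, sub_self, abs_zero, zero_mul]
    positivity
  · exact h

/-- A tournament with a long initial segment ordered linearly is not quasirandom. -/
lemma IsQuasirandomWith.sq_le {n k : ℕ} (hk : 2 * k ≤ n) {T : Tournament (Fin n)}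
    (hT : ∀ u v : Fin n, (u : ℕ) < 2 * k → (v : ℕ) < 2 * k → (T.Adj u v ↔ u < v)) {ε : ℝ}
    (hqr : T.IsQuasirandomWith ε) : (k : ℝ) ^ 2 ≤ 2 * ε * (n : ℝ) ^ 2 := by
  classical
  let σ : Fin n ≃ Fin (Fintype.card (Fin n)) := finCongr (Fintype.card_fin n).symm
  -- `r` reverses the initial segment of length $2k$. This gains no forward edge and loses at least
  -- the $k^2$ edges from its first half to its second, whereas quasirandomness allows a change of
  -- at most $2\varepsilon n^2$.
  let r : Fin n → Fin n := fun x => if hx : (x : ℕ) < 2 * k then ⟨2 * k - 1 - x, by omega⟩ else x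
  have hr : ∀ x, (r x : ℕ) = if (x : ℕ) < 2 * k then 2 * k - 1 - x else x := fun x => by
    simp only [r]; split_ifs <;> rfl
  have hinv : Function.Involutive r := fun x => by
    ext
    rw [hr, hr]
    split_ifs <;> omega
  let τ : Fin n ≃ Fin (Fintype.card (Fin n)) := hinv.toPerm.trans σ
  have hσ : ∀ x y, σ x < σ y ↔ (x : ℕ) < y := fun x y => Iff.rfl
  have hτ : ∀ x y, τ x < τ y ↔ (r x : ℕ) < r y := fun x y => Iff.rfl
  let emb : Fin k × Fin k → Fin n × Fin n := fun p =>
    (⟨p.1, by omega⟩, ⟨k + p.2, by omega⟩)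
  have hemb : Function.Injective emb := by
    rintro ⟨a, b⟩ ⟨c, d⟩ h
    simp only [emb, Prod.mk.injEq, Fin.mk.injEq] at h
    ext <;> dsimp only <;> omega
  have hcard : (Set.range emb).ncard = k ^ 2 := by
    rw [← Set.image_univ, Set.ncard_image_of_injective _ hemb, Set.ncard_univ]
    simp [sq]
  have hdisj : Disjoint (T.forwardEdges τ) (Set.range emb) := by
    rw [Set.disjoint_left]
    rintro _ he ⟨⟨a, b⟩, rfl⟩
    have h2 := (hτ _ _).1 he.2
    rw [hr, hr] at h2
    simp only [emb] at h2
    split_ifs at h2 <;> omega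
  have hsub : T.forwardEdges τ ∪ Set.range emb ⊆ T.forwardEdges σ := by
    rintro e (he | ⟨⟨a, b⟩, rfl⟩)
    · refine ⟨he.1, (hσ _ _).2 ?_⟩
      have h2 := (hτ _ _).1 he.2
      rw [hr, hr] at h2
      by_cases h : (e.1 : ℕ) < 2 * k ∧ (e.2 : ℕ) < 2 * k
      · exact Fin.lt_def.1 ((hT _ _ h.1 h.2).1 he.1)
      · split_ifs at h2 <;> omega
    · have hlt : ((emb (a, b)).1 : ℕ) < (emb (a, b)).2 := by
        simp only [emb]; omega
      refine ⟨(hT _ _ ?_ ?_).2 (Fin.lt_def.2 hlt), (hσ _ _).2 hlt⟩ <;>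
      · simp only [emb]; omega
  have hle : (T.forwardEdges τ).ncard + k ^ 2 ≤ (T.forwardEdges σ).ncard := by
    rw [← hcard, ← Set.ncard_union_eq hdisj]
    exact Set.ncard_le_ncard hsub
  have hle' : ((T.forwardEdges τ).ncard : ℝ) + (k : ℝ) ^ 2 ≤ (T.forwardEdges σ).ncard := by
    exact_mod_cast hle
  have h1 := (abs_le.1 (hqr σ)).2
  have h2 := (abs_le.1 (hqr τ)).1
  rw [Fintype.card_fin] at h1 h2
  linarith

/-- Equivalent to $h^2\le2^{h-1}$ after squaring; this first holds from $7$ on ($49\le64$, but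
$36>32$), whence the threshold. -/
lemma pow_self_le_two_pow_choose {h : ℕ} (hh : 7 ≤ h) : h ^ h ≤ 2 ^ h.choose 2 := by
  have h1 : h ^ 2 ≤ 2 ^ (h - 1) := by
    induction h, hh using Nat.le_induction with
    | base => norm_num
    | succ h hh ih =>
      obtain ⟨j, rfl⟩ := Nat.exists_eq_add_of_le' (show 1 ≤ h by omega)
      simp only [Nat.add_sub_cancel] at ih ⊢
      rw [pow_succ 2 j]
      nlinarith
  refine (Nat.pow_le_pow_iff_left two_ne_zero).1 ?_
  calc (h ^ h) ^ 2 = (h ^ 2) ^ h := by rw [← pow_mul, ← pow_mul, mul_comm]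
    _ ≤ (2 ^ (h - 1)) ^ h := by gcongr
    _ = _ := by
      rw [← pow_mul, ← pow_mul, Nat.choose_two_right,
        Nat.div_mul_cancel (Nat.even_mul_pred_self h).two_dvd, mul_comm]

/-- Sending each vertex of `H` to any of the `m` vertices of its own fibre gives an embedding. -/
lemma pow_le_embeddingCount_blowUp [Fintype W] (H : Tournament W) {h m : ℕ} (e : W ≃ Fin h) :
    m ^ Fintype.card W ≤
      embeddingCount H (blowUp H fun x : Fin (h * m) => e.symm x.divNat) := by
  classical
  rw [embeddingCount_eq_card]
  have : m ^ Fintype.card W = #(univ : Finset (W → Fin m)) := by simp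
  rw [this]
  refine card_le_card_of_injOn (fun f u => finProdFinEquiv (e u, f u)) (fun f _ => ?_) ?_
  · suffices IsLabelledEmbedding H _ fun u => finProdFinEquiv (e u, f u) by simpa using this
    intro u v
    have hB : ∀ u, e.symm (finProdFinEquiv (e u, f u)).divNat = u := fun u =>
      (e.symm_apply_eq).2 (congrArg Prod.fst (finProdFinEquiv.symm_apply_apply (e u, f u)))
    unfold blowUp
    dsimp only
    rw [hB u, hB v]
    rcases eq_or_ne u v with rfl | hne
    · simp [H.loopless]
    · simp [hne]
  · intro f _ g _ hfg
    funext u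
    have := finProdFinEquiv.injective (congrFun hfg u)
    exact (Prod.ext_iff.1 this).2

theorem IsGloballyForcing.isTransitive [Fintype W] {H : Tournament W}
    (hH : H.IsGloballyForcing) (hW : 7 ≤ Fintype.card W) : H.IsTransitive := by
  classical
  by_contra hnt
  set h := Fintype.card W with hh
  have hh0 : (0 : ℝ) < h := by exact_mod_cast (show 0 < h by omega)
  -- With $n=2kh$ this `ε` makes $2\varepsilon n^2=k^2/2$, contradicting `IsQuasirandomWith.sq_le`.
  obtain ⟨δ, hδ, n₀, hforce⟩ := hH (1 / (16 * (h : ℝ) ^ 2)) (by positivity)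
  obtain ⟨k₀, hk₀⟩ := exists_nat_gt ((h : ℝ) / δ)
  set k := max (max n₀ k₀) 1 with hk
  have hk1 : 1 ≤ k := le_max_right _ _
  have hkn : k ≤ h * (2 * k) := by nlinarith
  have hkn₀ : n₀ ≤ k := (le_max_left _ _).trans (le_max_left _ _)
  have hkk₀ : k₀ ≤ k := (le_max_right _ _).trans (le_max_left _ _)
  let e : W ≃ Fin h := Fintype.equivFin W
  let b : Fin (h * (2 * k)) → W := fun x => e.symm x.divNat
  have hb : ∀ x y : Fin (h * (2 * k)), (x : ℕ) < 2 * k → (y : ℕ) < 2 * k → b x = b y := by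
    intro x y hx hy
    refine congrArg e.symm (Fin.ext ?_)
    change (x : ℕ) / (2 * k) = (y : ℕ) / (2 * k)
    rw [Nat.div_eq_of_lt hx, Nat.div_eq_of_lt hy]
  set n : ℝ := ((h * (2 * k) : ℕ) : ℝ) with hn
  have hnpos : 0 < n := by rw [hn]; exact_mod_cast (by omega : 0 < h * (2 * k))
  have hcount0 : embeddingCount H (ofLinearOrder (Fin (h * (2 * k)))) = 0 := by
    rw [embeddingCount_eq_card, card_eq_zero, filter_eq_empty_iff]
    exact fun φ _ hφ => hnt (isTransitive_of_embedding hφ)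
  have hcount1 : ((2 : ℝ) ^ h.choose 2)⁻¹ * n ^ h ≤ embeddingCount H (blowUp H b) := by
    have h1 : ((2 * k : ℕ) : ℝ) ^ h ≤ embeddingCount H (blowUp H b) := by
      exact_mod_cast pow_le_embeddingCount_blowUp (m := 2 * k) H e
    refine le_trans ?_ h1
    rw [inv_mul_le_iff₀ (by positivity), hn, Nat.cast_mul, mul_pow]
    have h2 : (h : ℝ) ^ h ≤ 2 ^ h.choose 2 := by exact_mod_cast pow_self_le_two_pow_choose hW
    gcongr
  obtain ⟨S, hS⟩ := exists_splice_embeddingCount_near H (ofLinearOrder (Fin (h * (2 * k))))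
    (blowUp H b) (c := ((2 : ℝ) ^ h.choose 2)⁻¹ * n ^ h)
    (by rw [hcount0, Nat.cast_zero]; positivity) hcount1
  rw [Fintype.card_fin, ← hn, ← hh] at hS
  have hcorrect : HasCorrectCountWith H (splice (ofLinearOrder (Fin (h * (2 * k)))) (blowUp H b) S)
      δ := by
    unfold HasCorrectCountWith
    rw [Fintype.card_fin, ← hn, ← hh]
    refine le_of_mul_le_mul_right (hS.trans ?_) hnpos
    have h1 : (h : ℝ) ≤ δ * n := by
      rw [div_lt_iff₀ hδ] at hk₀
      have : (k₀ : ℝ) ≤ n := by rw [hn]; exact_mod_cast hkk₀.trans hkn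
      nlinarith
    calc (h : ℝ) * n ^ h ≤ (δ * n) * n ^ h := by gcongr
      _ = _ := by ring
  have hqr := hforce _ _ (by rw [Fintype.card_fin]; exact hkn₀.trans hkn) hcorrect
  -- On the first fibre both spliced tournaments are the linear order, so the choice of `S` is
  -- irrelevant there.
  have hsq := hqr.sq_le (k := k) (by nlinarith) fun u v hu hv => by
    simp [splice, blowUp, ofLinearOrder, hb u v hu hv]
    tauto
  have hk0 : (0 : ℝ) < k := by exact_mod_cast hk1
  have : 2 * (1 / (16 * (h : ℝ) ^ 2)) * ((h * (2 * k) : ℕ) : ℝ) ^ 2 = (k : ℝ) ^ 2 / 2 := by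
    push_cast
    field_simp
    norm_num
  rw [this] at hsq
  have : 0 < (k : ℝ) ^ 2 := by positivity
  linarith

end Tournament

theorem mainTheorem4 {W : Type*} [Fintype W] (H : Tournament W) :
    (7 ≤ Fintype.card W → (H.IsGloballyForcing ↔ H.IsTransitive)) ∧
      (4 ≤ Fintype.card W → H.IsTransitive → H.IsGloballyForcing) :=
  ⟨fun h => ⟨fun hH => hH.isTransitive h, fun hH => hH.isGloballyForcing (by omega)⟩,
    fun h hH => hH.isGloballyForcing h⟩
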